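/- Let $n\ge 2$ and $\lambda>0$, and let $\Lambda$ satisfy the distortion bound $$1\le \frac{\Lambda}{\lambda}<\frac{n+1}{n-1}.$$ Let $\mathcal A(\lambda,\Lambda)$ be the set of symmetric real $n\times n$ matrices $A$ with $\lambda|\xi|^2\le \xi^\top A\,\xi\le\Lambda|\xi|^2$ for all $\xi\in\mathbb R^n$, let $A^{1/2}$ denote the principal square root, let $B_\rho$ be the open ball of radius $\rho$ centred at $0$, and let $\mathbb B=B_1$. Call $\alpha\in(0,1)$ admissible if $$\frac{\Lambda}{\lambda}<\frac{n(1-\alpha)^{1/n}+(1-\alpha)}{n-1}.$$ Let $r>0$ and $\varepsilon>0$, let $\Omega\supset B_{2r}$, let $A:\Omega\to\mathcal A(\lambda,\Lambda)$, and let $u$ be a real function that is bounded on $B_{2r}$. For $C\in\mathbb R$ and $N\in\mathbb N$ define $f=f_1-f_2$ on $\mathbb R^n\times\mathbb R^n$, where $$f_1(x,z)=C|x-z|^\alpha+\widetilde C|x+z|^2,\qquad \widetilde C=\frac{2}{3r^2}\sup_{B_{2r}}|u|,$$ $$f_2(x,z)=\begin{cases} C^{2(2N-i)}\varepsilon^\alpha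 & \text{if } \frac{i-1}{2}<\frac{|x-z|}{\sqrt\lambda\,\varepsilon}\le\frac i2\quad (i=0,1,\dots,2N),\\[4pt] 0 & \text{if } \frac{|x-z|}{\sqrt\lambda\,\varepsilon}>N.\end{cases}$$ Then every sufficiently small $\alpha>0$ (depending on $n,\lambda,\Lambda$) is admissible. Moreover, for every admissible $\alpha$ there is a constant $C_0$ depending only on $n,\lambda,\Lambda,r,\alpha$ and $\sup_{B_{2r}}|u|$, and for every $C\ge C_0$ there is $N_0\in\mathbb N$ depending only on $\lambda,\Lambda$ and $C$, such that for all $C\ge C_0$ and all $N\ge N_0$ the following holds: for all $x,z\in B_r$ with $|x-z|>\frac12\sqrt\lambda\,\varepsilon$ there is an orthogonal matrix $Q\in O(n)$ such that the integrand below is integrable on $\mathbb B$ and, with $\eta=\varepsilon^2$, $$f(x,z)>\frac{1}{|\mathbb B|}\int_{\mathbb B} f\big(x+\varepsilon A(x)^{1/2}y,\;z+\varepsilon A(z)^{1/2}Qy\big)\,dy+\eta .$$ In particular, $C_0$ and $N_0$ do not depend on $\varepsilon$. -/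

import Mathlib

open scoped MatrixOrder

noncomputable section

namespace EllipsoidProcess

/-- `ℝⁿ` with the Euclidean norm. -/
abbrev E (n : ℕ) : Type := EuclideanSpace ℝ (Fin n)

/-- The set `𝒜(lam, Lam)` of symmetric real `n × n` matrices `A` with
`lam |ξ|² ≤ ξᵀ A ξ ≤ Lam |ξ|²` for every `ξ ∈ ℝⁿ`. -/
def ellipticMatrices (n : ℕ) (lam Lam : ℝ) : Set (Matrix (Fin n) (Fin n) ℝ) :=
  {A | A.IsSymm ∧ ∀ ξ : E n,
    lam * ‖ξ‖ ^ 2 ≤ inner ℝ ξ (Matrix.toEuclideanLin A ξ) ∧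
      inner ℝ ξ (Matrix.toEuclideanLin A ξ) ≤ Lam * ‖ξ‖ ^ 2}

/-- `sup_{B_ρ} |u|`, for a function `u` that is bounded on the open ball `B_ρ` centred at `0`. -/
def supBall {n : ℕ} (u : E n → ℝ) (ρ : ℝ) : ℝ :=
  sSup ((fun x => |u x|) '' Metric.ball (0 : E n) ρ)

/-- `f₁(x, z) = C |x - z|^α + C' |x + z|²`. -/
def f₁ {n : ℕ} (C C' α : ℝ) (x z : E n) : ℝ :=
  C * ‖x - z‖ ^ α + C' * ‖x + z‖ ^ 2

/-- The annular step function: `f₂(x, z) = C^{2(2N-i)} ε^α` if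
`(i-1)/2 < |x - z| / (√lam ε) ≤ i/2` for some `i = 0, 1, …, 2N` (the conditions for different `i`
exclude each other), and `f₂(x, z) = 0` if `|x - z| / (√lam ε) > N`. -/
def f₂ {n : ℕ} (C : ℝ) (N : ℕ) (α lam ε : ℝ) (x z : E n) : ℝ :=
  open Classical in
  ∑ i ∈ Finset.range (2 * N + 1),
    if ((i : ℝ) - 1) / 2 < ‖x - z‖ / (√lam * ε) ∧ ‖x - z‖ / (√lam * ε) ≤ (i : ℝ) / 2 then
      C ^ (2 * (2 * N - i)) * ε ^ α
    else 0

/-- The comparison function `f = f₁ - f₂`, where the coefficient of `|x + z|²` in `f₁` is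
`2 / (3 r²) · sup_{B_{2r}} |u|`. -/
def comparison {n : ℕ} (C : ℝ) (N : ℕ) (α lam ε r : ℝ) (u : E n → ℝ) (x z : E n) : ℝ :=
  f₁ C (2 / (3 * r ^ 2) * supBall u (2 * r)) α x z - f₂ C N α lam ε x z

/-- `y ↦ f(x + ε A(x)^{1/2} y, z + ε A(z)^{1/2} Q y)`, with `A^{1/2}` the principal square root. -/
def coupled {n : ℕ} (f : E n → E n → ℝ) (A : E n → Matrix (Fin n) (Fin n) ℝ) (ε : ℝ)
    (x z : E n) (Q : Matrix (Fin n) (Fin n) ℝ) (y : E n) : ℝ :=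
  f (x + ε • Matrix.toEuclideanLin (CFC.sqrt (A x)) y)
    (z + ε • Matrix.toEuclideanLin (CFC.sqrt (A z) * Q) y)

/-- The smallness condition on the exponent `α`:
`Lam / lam < (n (1 - α)^{1/n} + (1 - α)) / (n - 1)`. -/
def SmallExponent (n : ℕ) (lam Lam α : ℝ) : Prop :=
  0 < α ∧ α < 1 ∧
    Lam / lam < ((n : ℝ) * (1 - α) ^ (1 / (n : ℝ)) + (1 - α)) / ((n : ℝ) - 1)

end EllipsoidProcess

end

/-!
Split the mean of the coupled comparison function into the contributions of `|x - z|^α`, of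
`|x + z|²` and of the step function `f₂`. First-order terms are odd in `y` and average out, so the
`|x + z|²` part costs only `O(ε²)`.

If `|x - z| > N √lam ε`, then `f₂(x, z) = 0`, the average of `f₂` is nonnegative, and the gain comes
from `|x - z|^α`. At second order its mean changes by a positive multiple of the trace of `H D Dᵀ`,
where `H` is the Hessian of `|·|^α` at `x - z` and `D = A(x)^{1/2} - A(z)^{1/2} Q`. Choosing `Q` to
be the orthogonal polar factor of `A(z)^{1/2} H A(x)^{1/2}` maximizes the cross term, which the
arithmetic-geometric mean inequality bounds below through the determinants; this trace is then
negative exactly because `α` is admissible. The resulting decrease carries the factor `C`, so it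
beats the `O(ε²)` terms, and the cubic error is absorbed since `|x - z|` is at least `C √lam ε`.

If `|x - z| ≤ N √lam ε`, choose `Q` so that some direction moves `x` and `z` straight towards each
other. A ball of radius `√lam / (8 √Lam)` of steps then lands in an annulus of smaller index, where
`f₂` is at least `C²` times larger; for large `C` this gain, quadratic in `C`, beats the loss of
`|x - z|^α`, which is linear in `C`.
-/

namespace EllipsoidProcess

open MeasureTheory Metric Matrix

section PowerExpansion

theorem one_add_mul_le_rpow_of_nonpos {p s : ℝ} (hp : p ≤ 0) (hs : -1 < s) :
    1 + p * s ≤ (1 + s) ^ p := by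
  have hs' : 0 < 1 + s := by linarith
  calc 1 + p * s ≤ 1 + p * Real.log (1 + s) := by
        have hlog : Real.log (1 + s) ≤ s := by linarith [Real.log_le_sub_one_of_pos hs']
        linarith [mul_le_mul_of_nonpos_left hlog hp]
    _ ≤ Real.exp (p * Real.log (1 + s)) := by linarith [Real.add_one_le_exp (p * Real.log (1 + s))]
    _ = (1 + s) ^ p := by rw [Real.rpow_def_of_pos hs', mul_comm]

theorem hasDerivAt_one_add_rpow (b : ℝ) {t : ℝ} (ht : -1 < t) :
    HasDerivAt (fun t : ℝ => (1 + t) ^ b) (b * (1 + t) ^ (b - 1)) t := by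
  simpa using ((hasDerivAt_id t).const_add 1).rpow_const (p := b) (Or.inl (by simp; linarith))

theorem isMinOn_of_hasDerivAt2_nonneg {S : Set ℝ} (hS : Convex ℝ S) (hSo : IsOpen S)
    {f f' f'' : ℝ → ℝ} (hf : ∀ t ∈ S, HasDerivAt f (f' t) t)
    (hf' : ∀ t ∈ S, HasDerivAt f' (f'' t) t) (hf'' : ∀ t ∈ S, 0 ≤ f'' t) {a : ℝ} (ha : a ∈ S)
    (hfa : f' a = 0) : IsMinOn f S a := by
  have hconvex : ConvexOn ℝ S f := by
    refine convexOn_of_hasDerivWithinAt2_nonneg (f' := f') (f'' := f'') hS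
      (fun t ht => (hf t ht).continuousAt.continuousWithinAt) ?_ ?_ ?_ <;>
      rw [hSo.interior_eq]
    exacts [fun t ht => (hf t ht).hasDerivWithinAt, fun t ht => (hf' t ht).hasDerivWithinAt, hf'']
  refine hconvex.isMinOn_of_rightDeriv_eq_zero (hSo.interior_eq.symm ▸ ha) ?_
  rw [(hf a ha).hasDerivWithinAt.derivWithin (uniqueDiffWithinAt_Ioi a), hfa]

theorem one_add_rpow_le_cubic {b s : ℝ} (hb₀ : 0 ≤ b) (hb₁ : b ≤ 1) (hs : -1 < s) :
    (1 + s) ^ b ≤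
      1 + b * s - b * (1 - b) / 2 * s ^ 2 + b * (1 - b) * (2 - b) / 6 * s ^ 3 := by
  let φ : ℝ → ℝ := fun t => 1 + b * t - b * (1 - b) / 2 * t ^ 2 +
    b * (1 - b) * (2 - b) / 6 * t ^ 3 - (1 + t) ^ b
  let φ' : ℝ → ℝ := fun t => b - b * (1 - b) * t + b * (1 - b) * (2 - b) / 2 * t ^ 2 -
    b * (1 + t) ^ (b - 1)
  have hφ : ∀ t ∈ Set.Ioi (-1), HasDerivAt φ (φ' t) t := fun t ht => by
    have hquadratic := ((hasDerivAt_pow 2 t).const_mul (b * (1 - b) / 2))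
    have hcubic := ((hasDerivAt_pow 3 t).const_mul (b * (1 - b) * (2 - b) / 6))
    refine ((((((hasDerivAt_id t).const_mul b).const_add 1).sub hquadratic).add hcubic).sub
      (hasDerivAt_one_add_rpow b ht)).congr_deriv ?_
    simp only [φ']
    ring
  have hφ' : ∀ t ∈ Set.Ioi (-1),
      HasDerivAt φ' (b * (1 - b) * ((1 + t) ^ (b - 2) - (1 + (b - 2) * t))) t := fun t ht => by
    have hquadratic := ((hasDerivAt_pow 2 t).const_mul (b * (1 - b) * (2 - b) / 2))
    refine ((((((hasDerivAt_id t).const_mul (b * (1 - b))).const_sub b).add hquadratic).sub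
      ((hasDerivAt_one_add_rpow (b - 1) ht).const_mul b))).congr_deriv ?_
    rw [show b - 1 - 1 = b - 2 by ring]
    ring
  have hmin : IsMinOn φ (Set.Ioi (-1)) 0 := by
    refine isMinOn_of_hasDerivAt2_nonneg (convex_Ioi _) isOpen_Ioi hφ hφ'
      (fun t ht => ?_) (by simp) (by simp [φ'])
    have hbernoulli := one_add_mul_le_rpow_of_nonpos (by linarith : b - 2 ≤ 0) ht
    exact mul_nonneg (mul_nonneg hb₀ (by linarith)) (by linarith)
  have hφs : φ 0 ≤ φ s := hmin hs
  norm_num [φ] at hφs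
  linarith

variable {F : Type*} [NormedAddCommGroup F] [InnerProductSpace ℝ F]

theorem norm_unit_add_rpow_le {α : ℝ} (hα₀ : 0 ≤ α) (hα₂ : α ≤ 2) {e w : F} (he : ‖e‖ = 1)
    (hw : ‖w‖ < 1) :
    ‖e + w‖ ^ α ≤ 1 + α * inner ℝ e w +
      α / 2 * (‖w‖ ^ 2 - (2 - α) * inner ℝ e w ^ 2) + 6 * α * ‖w‖ ^ 3 := by
  set p := inner ℝ e w
  set q := ‖w‖
  have hq : 0 ≤ q := norm_nonneg w
  obtain ⟨hp₁, hp₂⟩ : -q ≤ p ∧ p ≤ q :=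
    abs_le.1 (by simpa [he] using abs_real_inner_le_norm e w)
  have hsq : ‖e + w‖ ^ 2 = 1 + (2 * p + q ^ 2) := by
    rw [norm_add_sq_real, he]
    ring
  have hs : -1 < 2 * p + q ^ 2 := by nlinarith [sq_pos_of_pos (sub_pos.2 hw)]
  have hpow : ‖e + w‖ ^ α = (1 + (2 * p + q ^ 2)) ^ (α / 2) := by
    rw [← hsq, ← Real.rpow_natCast_mul (norm_nonneg _)]
    congr 1
    push_cast
    ring
  have hcube : (2 * p + q ^ 2) ^ 3 ≤ 27 * q ^ 3 := by
    calc (2 * p + q ^ 2) ^ 3 ≤ (3 * q) ^ 3 := Odd.pow_le_pow (by decide) |>.2 (by nlinarith)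
      _ = 27 * q ^ 3 := by ring
  have hsquare : 4 * p ^ 2 - 4 * q ^ 3 ≤ (2 * p + q ^ 2) ^ 2 := by
    have : 0 ≤ (p + q) * q ^ 2 := mul_nonneg (by linarith) (by positivity)
    nlinarith [sq_nonneg (q ^ 2)]
  have hcoeff₂ : 0 ≤ α / 2 * (1 - α / 2) / 2 := by nlinarith
  have hcoeff₃ : 0 ≤ α / 2 * (1 - α / 2) * (2 - α / 2) / 6 := by
    have : 0 ≤ α / 2 * (1 - α / 2) := by linarith
    have := mul_nonneg this (by linarith : 0 ≤ 2 - α / 2)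
    linarith
  have herror : (α / 2 * (1 - α / 2) / 2 * 4 + α / 2 * (1 - α / 2) * (2 - α / 2) / 6 * 27) * q ^ 3 ≤
      6 * α * q ^ 3 := by
    gcongr
    nlinarith [mul_nonneg hα₀ (sub_nonneg.2 hα₂), mul_nonneg (mul_nonneg hα₀ hα₀) hα₀,
      mul_nonneg hα₀ hα₀]
  rw [hpow]
  refine (one_add_rpow_le_cubic (by linarith) (by linarith) hs).trans ?_
  linarith [mul_le_mul_of_nonneg_left hsquare hcoeff₂, mul_le_mul_of_nonneg_left hcube hcoeff₃]

theorem norm_add_rpow_le {α : ℝ} (hα₀ : 0 ≤ α) (hα₂ : α ≤ 2) {v w : F} (hw : ‖w‖ < ‖v‖) :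
    ‖v + w‖ ^ α ≤ ‖v‖ ^ α * (1 + α * (inner ℝ (‖v‖⁻¹ • v) w / ‖v‖) +
      α / 2 * ((‖w‖ ^ 2 - (2 - α) * inner ℝ (‖v‖⁻¹ • v) w ^ 2) / ‖v‖ ^ 2) +
      6 * α * (‖w‖ / ‖v‖) ^ 3) := by
  have hv : 0 < ‖v‖ := (norm_nonneg w).trans_lt hw
  have hscale : v + w = ‖v‖ • (‖v‖⁻¹ • v + ‖v‖⁻¹ • w) := by
    rw [smul_add, smul_inv_smul₀ hv.ne', smul_inv_smul₀ hv.ne']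
  have hnorm : ‖‖v‖⁻¹ • w‖ = ‖w‖ / ‖v‖ := by
    rw [norm_smul, norm_inv, norm_norm, inv_mul_eq_div]
  have hunit := norm_unit_add_rpow_le hα₀ hα₂ (norm_smul_inv_norm (𝕜 := ℝ) (norm_pos_iff.1 hv))
    (hnorm.trans_lt ((div_lt_one hv).2 hw))
  calc ‖v + w‖ ^ α = ‖v‖ ^ α * ‖‖v‖⁻¹ • v + ‖v‖⁻¹ • w‖ ^ α := by
        rw [hscale, norm_smul, norm_norm, Real.mul_rpow (norm_nonneg _) (norm_nonneg _)]
    _ ≤ _ := by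
        gcongr
        refine hunit.trans_eq ?_
        rw [hnorm, RCLike.ofReal_real_eq_id, id, inner_smul_right]
        ring

end PowerExpansion

section RealMatrix

variable {ι : Type*} [Fintype ι] [DecidableEq ι]

theorem card_mul_det_rpow_le_trace {P : Matrix ι ι ℝ} (hP : P.PosSemidef) :
    Fintype.card ι * P.det ^ (1 / (Fintype.card ι : ℝ)) ≤ P.trace := by
  rcases isEmpty_or_nonempty ι
  · simp
  have hcard : (0 : ℝ) < Fintype.card ι := by exact_mod_cast Fintype.card_pos
  have hmean := Real.geom_mean_le_arith_mean_weighted Finset.univ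
    (fun _ : ι => 1 / (Fintype.card ι : ℝ)) hP.1.eigenvalues (fun _ _ => by positivity)
    (by simp [hcard.ne']) (fun i _ => hP.eigenvalues_nonneg i)
  rw [← Finset.mul_sum, one_div, ← div_eq_inv_mul, le_div_iff₀' hcard,
    Real.finsetProd_rpow _ _ (fun i _ => hP.eigenvalues_nonneg i)] at hmean
  simpa [hP.1.det_eq_prod_eigenvalues, hP.1.trace_eq_sum_eigenvalues] using hmean

omit [DecidableEq ι] in
theorem dotProduct_mulVec_le_trace_mul {P : Matrix ι ι ℝ} (hP : P.PosSemidef) (v : ι → ℝ) :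
    v ⬝ᵥ P *ᵥ v ≤ P.trace * (v ⬝ᵥ v) := by
  classical
  obtain ⟨S, rfl⟩ := CStarAlgebra.nonneg_iff_eq_star_mul_self.1 hP.nonneg
  rw [star_eq_conjTranspose]
  have hquadratic : v ⬝ᵥ (Sᴴ * S) *ᵥ v = ∑ i, (S i ⬝ᵥ v) ^ 2 := by
    rw [← mulVec_mulVec, dotProduct_mulVec, conjTranspose_eq_transpose_of_trivial,
      vecMul_transpose]
    simp only [dotProduct, mulVec, sq]
  have htrace : (Sᴴ * S).trace = ∑ i, ∑ j, S i j ^ 2 := by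
    rw [trace_mul_comm]
    simp [trace, mul_apply, sq]
  rw [hquadratic, htrace, Finset.sum_mul]
  refine Finset.sum_le_sum fun i _ => ?_
  simpa only [dotProduct, ← sq] using Finset.sum_mul_sq_le_sq_mul_sq Finset.univ (S i) v

omit [Fintype ι] [DecidableEq ι] in
theorem transpose_eq_of_nonneg {P : Matrix ι ι ℝ} (hP : 0 ≤ P) : Pᵀ = P := by
  simpa [IsHermitian] using hP.posSemidef.1

theorem exists_orthogonal_transpose_mul_eq_sqrt {X : Matrix ι ι ℝ} (hX : X.det ≠ 0) :
    ∃ Q ∈ orthogonalGroup ι ℝ, Qᵀ * X = CFC.sqrt (Xᵀ * X) := by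
  have hXX : 0 ≤ Xᵀ * X := by
    simpa [nonneg_iff_posSemidef] using posSemidef_conjTranspose_mul_self X
  set P := CFC.sqrt (Xᵀ * X)
  have hPP : P * P = Xᵀ * X := CFC.sqrt_mul_sqrt_self _ hXX
  have hPunit : IsUnit P.det := by
    have hdet : P.det * P.det = X.det * X.det := by
      simpa only [det_mul, det_transpose] using congrArg det hPP
    exact isUnit_of_mul_isUnit_left (hdet ▸ (mul_ne_zero hX hX).isUnit)
  have htranspose : (X * P⁻¹)ᵀ = P⁻¹ * Xᵀ := by
    rw [transpose_mul, transpose_nonsing_inv,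
      transpose_eq_of_nonneg (CFC.sqrt_nonneg _)]
  have hpolar : (X * P⁻¹)ᵀ * X = P := by
    rw [htranspose, Matrix.mul_assoc, ← hPP, nonsing_inv_mul_cancel_left _ _ hPunit]
  refine ⟨X * P⁻¹, ?_, hpolar⟩
  rw [mem_orthogonalGroup_iff', ← Matrix.mul_assoc, hpolar, mul_nonsing_inv _ hPunit]

theorem exists_orthogonal_card_mul_det_rpow_le_trace (X : Matrix ι ι ℝ) :
    ∃ Q ∈ orthogonalGroup ι ℝ,
      Fintype.card ι * |X.det| ^ (1 / (Fintype.card ι : ℝ)) ≤ (Qᵀ * X).trace := by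
  rcases eq_or_ne X.det 0 with hX | hX
  · have hzero : Fintype.card ι * |X.det| ^ (1 / (Fintype.card ι : ℝ)) = 0 := by
      rcases isEmpty_or_nonempty ι <;> simp [hX]
    rw [hzero]
    rcases le_total 0 X.trace with htrace | htrace
    · exact ⟨1, one_mem _, by simpa using htrace⟩
    · exact ⟨-1, by simp [mem_orthogonalGroup_iff], by simpa using htrace⟩
  · obtain ⟨Q, hQ, hpolar⟩ := exists_orthogonal_transpose_mul_eq_sqrt hX
    refine ⟨Q, hQ, ?_⟩
    have hP : (Qᵀ * X).PosSemidef := hpolar ▸ nonneg_iff_posSemidef.1 (CFC.sqrt_nonneg _)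
    have hQdet : |Q.det| = 1 := by
      rw [← Real.norm_eq_abs]
      exact CStarRing.norm_of_mem_unitary (det_of_mem_unitary hQ)
    have hdet : (Qᵀ * X).det = |X.det| := by
      rw [← abs_of_nonneg hP.det_nonneg, det_mul, abs_mul, det_transpose, hQdet, one_mul]
    exact hdet ▸ card_mul_det_rpow_le_trace hP

/-- The matrix `I - (2 - α) e ⊗ e`, which is `α⁻¹` times the Hessian of `|·|^α` at a unit
vector `e`. -/
def normRpowHessian (α : ℝ) (e : ι → ℝ) : Matrix ι ι ℝ :=
  1 - (2 - α) • vecMulVec e e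

omit [Fintype ι] in
theorem transpose_normRpowHessian (α : ℝ) (e : ι → ℝ) :
    (normRpowHessian α e)ᵀ = normRpowHessian α e := by
  simp [normRpowHessian, transpose_vecMulVec]

theorem det_normRpowHessian (α : ℝ) {e : ι → ℝ} (he : e ⬝ᵥ e = 1) :
    (normRpowHessian α e).det = α - 1 := by
  have hrankOne : normRpowHessian α e =
      1 + replicateCol Unit ((α - 2) • e) * replicateRow Unit e := by
    rw [normRpowHessian, ← vecMulVec_eq, smul_vecMulVec]
    module
  rw [hrankOne, det_one_add_replicateCol_mul_replicateRow, dotProduct_smul, he]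
  simp only [smul_eq_mul]
  ring

theorem dotProduct_normRpowHessian_mulVec (α : ℝ) (e v : ι → ℝ) :
    v ⬝ᵥ normRpowHessian α e *ᵥ v = v ⬝ᵥ v - (2 - α) * (e ⬝ᵥ v) ^ 2 := by
  simp only [normRpowHessian, sub_mulVec, smul_mulVec, vecMulVec_mulVec, dotProduct_smul,
    dotProduct_comm v e, one_mulVec, dotProduct_sub, op_smul_eq_smul, smul_eq_mul]
  ring

theorem trace_normRpowHessian_mul (α : ℝ) (e : ι → ℝ) (A : Matrix ι ι ℝ) :
    (normRpowHessian α e * A).trace = A.trace - (2 - α) * (e ⬝ᵥ A *ᵥ e) := by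
  rw [normRpowHessian, Matrix.sub_mul, Matrix.one_mul, trace_sub, Matrix.smul_mul, trace_smul,
    vecMulVec_mul, trace_vecMulVec, dotProduct_comm, ← dotProduct_mulVec, smul_eq_mul]

theorem trace_sub_mul_conj {S R H Q : Matrix ι ι ℝ} (hS : Sᵀ = S) (hR : Rᵀ = R) (hH : Hᵀ = H)
    (hQ : Q ∈ orthogonalGroup ι ℝ) :
    ((S - R * Q)ᵀ * H * (S - R * Q)).trace =
      (H * (S * S)).trace + (H * (R * R)).trace - 2 * (Qᵀ * (R * H * S)).trace := by
  have hcross : (S * H * (R * Q)).trace = (Qᵀ * (R * H * S)).trace := by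
    rw [← trace_transpose]
    simp only [transpose_mul, hS, hR, hH, Matrix.mul_assoc]
  have hdiag : (Qᵀ * R * H * (R * Q)).trace = (H * (R * R)).trace := by
    calc (Qᵀ * R * H * (R * Q)).trace = (Qᵀ * (R * H * R) * Q).trace := by
          simp only [Matrix.mul_assoc]
      _ = (R * (H * R)).trace := by
          rw [trace_mul_cycle, (mem_orthogonalGroup_iff _ _).1 hQ, Matrix.one_mul,
            Matrix.mul_assoc]
      _ = (H * (R * R)).trace := by rw [trace_mul_comm, Matrix.mul_assoc]
  have hexpand : (S - R * Q)ᵀ * H * (S - R * Q) =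
      S * H * S - S * H * (R * Q) - Qᵀ * (R * H * S) + Qᵀ * R * H * (R * Q) := by
    rw [transpose_sub, transpose_mul, hS, hR]
    noncomm_ring
  rw [hexpand, trace_add, trace_sub, trace_sub, hcross, hdiag, trace_mul_comm (S * H) S,
    ← Matrix.mul_assoc S S H, trace_mul_comm (S * S) H]
  ring

end RealMatrix

section EuclideanSpace

variable {ι : Type*} [Fintype ι] [DecidableEq ι]

omit [DecidableEq ι] in
theorem norm_sq_eq_dotProduct (v : EuclideanSpace ℝ ι) : ‖v‖ ^ 2 = v.ofLp ⬝ᵥ v.ofLp := by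
  rw [EuclideanSpace.real_norm_sq_eq]
  simp only [dotProduct, sq]

theorem inner_toEuclideanLin (M : Matrix ι ι ℝ) (v w : EuclideanSpace ℝ ι) :
    inner ℝ v (toEuclideanLin M w) = v.ofLp ⬝ᵥ M *ᵥ w.ofLp := by
  simp [EuclideanSpace.inner_eq_star_dotProduct, dotProduct_comm]

theorem norm_toEuclideanLin_of_mem_orthogonalGroup {Q : Matrix ι ι ℝ} (hQ : Q ∈ orthogonalGroup ι ℝ)
    (y : EuclideanSpace ℝ ι) : ‖toEuclideanLin Q y‖ = ‖y‖ := by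
  rw [← sq_eq_sq₀ (norm_nonneg _) (norm_nonneg _), norm_sq_eq_dotProduct, norm_sq_eq_dotProduct,
    ofLp_toLpLin, toLin'_apply, dotProduct_mulVec, ← mulVec_transpose, mulVec_mulVec,
    (mem_orthogonalGroup_iff' _ _).1 hQ, one_mulVec]

theorem exists_orthogonal_map_eq {v w : EuclideanSpace ℝ ι} (h : ‖v‖ = ‖w‖) :
    ∃ Q ∈ orthogonalGroup ι ℝ, toEuclideanLin Q v = w := by
  let ρ := (ℝ ∙ (v - w))ᗮ.reflection
  let b := EuclideanSpace.basisFun ι ℝ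
  refine ⟨_, ρ.toMatrix_mem_unitaryGroup b b, ?_⟩
  rw [toEuclideanLin_eq_toLin_orthonormal, toLin_toMatrix]
  exact Submodule.reflection_sub h

end EuclideanSpace

section Ellipticity

variable {n : ℕ} {lam Lam α : ℝ} {A B Q : Matrix (Fin n) (Fin n) ℝ}

namespace ellipticMatrices

theorem le_dotProduct_mulVec (hA : A ∈ ellipticMatrices n lam Lam) (v : Fin n → ℝ) :
    lam * (v ⬝ᵥ v) ≤ v ⬝ᵥ A *ᵥ v := by
  simpa only [inner_toEuclideanLin, norm_sq_eq_dotProduct] using (hA.2 (WithLp.toLp 2 v)).1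

theorem dotProduct_mulVec_le (hA : A ∈ ellipticMatrices n lam Lam) (v : Fin n → ℝ) :
    v ⬝ᵥ A *ᵥ v ≤ Lam * (v ⬝ᵥ v) := by
  simpa only [inner_toEuclideanLin, norm_sq_eq_dotProduct] using (hA.2 (WithLp.toLp 2 v)).2

theorem isHermitian (hA : A ∈ ellipticMatrices n lam Lam) : A.IsHermitian := by
  simpa [IsHermitian] using hA.1.eq

theorem posSemidef (hlam : 0 ≤ lam) (hA : A ∈ ellipticMatrices n lam Lam) : A.PosSemidef :=
  .of_dotProduct_mulVec_nonneg (isHermitian hA) fun v =>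
    (mul_nonneg hlam (dotProduct_self_star_nonneg v)).trans (le_dotProduct_mulVec hA v)

theorem sqrt_mul_sqrt (hlam : 0 ≤ lam) (hA : A ∈ ellipticMatrices n lam Lam) :
    CFC.sqrt A * CFC.sqrt A = A :=
  CFC.sqrt_mul_sqrt_self _ (posSemidef hlam hA).nonneg

theorem pow_le_det (hlam : 0 ≤ lam) (hA : A ∈ ellipticMatrices n lam Lam) : lam ^ n ≤ A.det := by
  have hherm := isHermitian hA
  have hpow : lam ^ n = ∏ _i : Fin n, lam := by simp
  rw [hpow, hherm.det_eq_prod_eigenvalues]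
  simp only [RCLike.ofReal_real_eq_id, id]
  refine Finset.prod_le_prod (fun _ _ => hlam) fun i _ => ?_
  have hunit : ‖hherm.eigenvectorBasis i‖ ^ 2 = 1 := by simp
  have hle := le_dotProduct_mulVec hA (hherm.eigenvectorBasis i).ofLp
  rw [hherm.mulVec_eigenvectorBasis i, dotProduct_smul, ← norm_sq_eq_dotProduct, hunit] at hle
  simpa using hle

theorem norm_sq_sqrt (hlam : 0 ≤ lam) (hA : A ∈ ellipticMatrices n lam Lam) (y : E n) :
    ‖toEuclideanLin (CFC.sqrt A) y‖ ^ 2 = inner ℝ y (toEuclideanLin A y) := by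
  nth_rewrite 2 [← sqrt_mul_sqrt hlam hA]
  rw [norm_sq_eq_dotProduct, ofLp_toLpLin, toLin'_apply, inner_toEuclideanLin, ← mulVec_mulVec,
    dotProduct_mulVec y.ofLp, ← mulVec_transpose, transpose_eq_of_nonneg (CFC.sqrt_nonneg _)]

theorem norm_sqrt_le (hlam : 0 ≤ lam) (hA : A ∈ ellipticMatrices n lam Lam) (y : E n) :
    ‖toEuclideanLin (CFC.sqrt A) y‖ ≤ √Lam * ‖y‖ := by
  rw [← Real.sqrt_sq (norm_nonneg (toEuclideanLin (CFC.sqrt A) y)), norm_sq_sqrt hlam hA,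
    ← Real.sqrt_sq (norm_nonneg y), ← Real.sqrt_mul' _ (sq_nonneg _)]
  exact Real.sqrt_le_sqrt (hA.2 y).2

theorem le_norm_sqrt (hlam : 0 ≤ lam) (hA : A ∈ ellipticMatrices n lam Lam) (y : E n) :
    √lam * ‖y‖ ≤ ‖toEuclideanLin (CFC.sqrt A) y‖ := by
  rw [← Real.sqrt_sq (norm_nonneg (toEuclideanLin (CFC.sqrt A) y)), norm_sq_sqrt hlam hA,
    ← Real.sqrt_sq (norm_nonneg y), ← Real.sqrt_mul' _ (sq_nonneg _)]
  exact Real.sqrt_le_sqrt (hA.2 y).1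

theorem norm_sqrt_mul_le (hlam : 0 ≤ lam) (hA : A ∈ ellipticMatrices n lam Lam)
    (hQ : Q ∈ orthogonalGroup (Fin n) ℝ) (y : E n) :
    ‖toEuclideanLin (CFC.sqrt A * Q) y‖ ≤ √Lam * ‖y‖ := by
  rw [toLpLin_mul_same, LinearMap.comp_apply, ← norm_toEuclideanLin_of_mem_orthogonalGroup hQ y]
  exact norm_sqrt_le hlam hA _

theorem exists_sqrt_eq_smul (hlam : 0 < lam) (hA : A ∈ ellipticMatrices n lam Lam) {e : E n}
    (he : ‖e‖ = 1) :
    ∃ y : E n, ‖y‖ = 1 ∧ ∃ a, √lam ≤ a ∧ toEuclideanLin (CFC.sqrt A) y = a • e := by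
  have hsqrt : 0 < √lam := Real.sqrt_pos.2 hlam
  have hinjective : Function.Injective (toEuclideanLin (CFC.sqrt A)) := by
    refine (injective_iff_map_eq_zero _).2 fun y hy => norm_le_zero_iff.1 ?_
    have hle := le_norm_sqrt hlam.le hA y
    rw [hy, norm_zero] at hle
    exact nonpos_of_mul_nonpos_right hle hsqrt
  obtain ⟨p, hp⟩ := LinearMap.injective_iff_surjective.1 hinjective e
  have hle : √lam * ‖p‖ ≤ 1 := he ▸ hp ▸ le_norm_sqrt hlam.le hA p
  have hp₀ : p ≠ 0 := by
    rintro rfl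
    simp [← hp] at he
  refine ⟨‖p‖⁻¹ • p, norm_smul_inv_norm hp₀, ‖p‖⁻¹, ?_, by rw [map_smul, hp]⟩
  rwa [← one_div, le_div_iff₀ (norm_pos_iff.2 hp₀)]

theorem trace_normRpowHessian_mul_le (hα : α ≤ 1) (hA : A ∈ ellipticMatrices n lam Lam)
    {e : Fin n → ℝ} (he : e ⬝ᵥ e = 1) :
    (normRpowHessian α e * A).trace ≤ (n - 1) * Lam - (1 - α) * lam := by
  have hcomplement : (Lam • (1 : Matrix (Fin n) (Fin n) ℝ) - A).PosSemidef := by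
    refine .of_dotProduct_mulVec_nonneg ?_ fun v => ?_
    · simp [IsHermitian, hA.1.eq]
    · simpa [sub_mulVec, smul_mulVec] using dotProduct_mulVec_le hA v
  have htrace : Lam - e ⬝ᵥ A *ᵥ e ≤ Lam * n - A.trace := by
    simpa [sub_mulVec, smul_mulVec, he] using dotProduct_mulVec_le_trace_mul hcomplement e
  have hlower : lam ≤ e ⬝ᵥ A *ᵥ e := by simpa [he] using le_dotProduct_mulVec hA e
  rw [trace_normRpowHessian_mul]
  linarith [mul_le_mul_of_nonneg_left hlower (sub_nonneg.2 hα)]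

end ellipticMatrices

theorem exists_forall_smallExponent (h : Lam / lam < ((n : ℝ) + 1) / ((n : ℝ) - 1)) :
    ∃ α₀ : ℝ, 0 < α₀ ∧ ∀ α : ℝ, 0 < α → α < α₀ → SmallExponent n lam Lam α := by
  have hcontinuous : ContinuousAt (fun α : ℝ =>
      ((n : ℝ) * (1 - α) ^ (1 / (n : ℝ)) + (1 - α)) / ((n : ℝ) - 1)) 0 := by
    have : ContinuousAt (fun α : ℝ => (1 - α) ^ (1 / (n : ℝ))) 0 :=
      ContinuousAt.rpow_const (by fun_prop) (Or.inl (by norm_num))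
    fun_prop
  have hnear := hcontinuous.eventually (lt_mem_nhds (a := Lam / lam) (by simpa using h))
  obtain ⟨δ, hδ, hball⟩ := Metric.eventually_nhds_iff.1 hnear
  refine ⟨min δ 1, lt_min hδ one_pos, fun α h₀ h₁ => ⟨h₀, h₁.trans_le (min_le_right _ _), ?_⟩⟩
  refine hball ?_
  rw [Real.dist_eq, sub_zero, abs_of_pos h₀]
  exact h₁.trans_le (min_le_left _ _)

/-- The amount by which an admissible exponent beats the distortion: under the optimal coupling,
the trace of the second-order term of `|x - z|^α` is at most minus this gap. -/
noncomputable def ellipticityGap (n : ℕ) (lam Lam α : ℝ) : ℝ :=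
  2 * (n * (1 - α) ^ (1 / (n : ℝ)) * lam) - 2 * ((n - 1) * Lam - (1 - α) * lam)

theorem SmallExponent.ellipticityGap_pos (hn : 2 ≤ n) (hlam : 0 < lam)
    (h : SmallExponent n lam Lam α) : 0 < ellipticityGap n lam Lam α := by
  have hn' : (0 : ℝ) < n - 1 := by
    have : (2 : ℝ) ≤ n := by exact_mod_cast hn
    linarith
  have hdistortion := (div_lt_div_iff₀ hlam hn').1 h.2.2
  rw [ellipticityGap]
  linarith

/-- The matrix by which a step `y` of the coupled process displaces `x - z`, where `A` and `B` are
the values of the coefficient field at `x` and `z`. -/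
noncomputable def diffDisplacement (A B Q : Matrix (Fin n) (Fin n) ℝ) : Matrix (Fin n) (Fin n) ℝ :=
  CFC.sqrt A - CFC.sqrt B * Q

/-- The matrix by which a step `y` of the coupled process displaces `x + z`, where `A` and `B` are
the values of the coefficient field at `x` and `z`. -/
noncomputable def sumDisplacement (A B Q : Matrix (Fin n) (Fin n) ℝ) : Matrix (Fin n) (Fin n) ℝ :=
  CFC.sqrt A + CFC.sqrt B * Q

theorem norm_diffDisplacement_le (hlam : 0 ≤ lam) (hA : A ∈ ellipticMatrices n lam Lam)
    (hB : B ∈ ellipticMatrices n lam Lam) (hQ : Q ∈ orthogonalGroup (Fin n) ℝ) (y : E n) :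
    ‖toEuclideanLin (diffDisplacement A B Q) y‖ ≤ 2 * √Lam * ‖y‖ := by
  rw [diffDisplacement, map_sub, LinearMap.sub_apply]
  linarith [norm_sub_le (toEuclideanLin (CFC.sqrt A) y) (toEuclideanLin (CFC.sqrt B * Q) y),
    ellipticMatrices.norm_sqrt_le hlam hA y, ellipticMatrices.norm_sqrt_mul_le hlam hB hQ y]

theorem norm_sumDisplacement_le (hlam : 0 ≤ lam) (hA : A ∈ ellipticMatrices n lam Lam)
    (hB : B ∈ ellipticMatrices n lam Lam) (hQ : Q ∈ orthogonalGroup (Fin n) ℝ) (y : E n) :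
    ‖toEuclideanLin (sumDisplacement A B Q) y‖ ≤ 2 * √Lam * ‖y‖ := by
  rw [sumDisplacement, map_add, LinearMap.add_apply]
  linarith [norm_add_le (toEuclideanLin (CFC.sqrt A) y) (toEuclideanLin (CFC.sqrt B * Q) y),
    ellipticMatrices.norm_sqrt_le hlam hA y, ellipticMatrices.norm_sqrt_mul_le hlam hB hQ y]

theorem le_abs_det_sqrt_mul_hessian_mul_sqrt (hlam : 0 ≤ lam)
    (hA : A ∈ ellipticMatrices n lam Lam) (hB : B ∈ ellipticMatrices n lam Lam)
    {e : Fin n → ℝ} (he : e ⬝ᵥ e = 1) :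
    (1 - α) * lam ^ n ≤ |(CFC.sqrt B * normRpowHessian α e * CFC.sqrt A).det| := by
  have hdet : (CFC.sqrt B * normRpowHessian α e * CFC.sqrt A).det ^ 2 =
      (1 - α) ^ 2 * (A.det * B.det) := by
    nth_rewrite 2 [← ellipticMatrices.sqrt_mul_sqrt hlam hA,
      ← ellipticMatrices.sqrt_mul_sqrt hlam hB]
    simp only [det_mul, det_normRpowHessian α he]
    ring
  refine (le_abs_self _).trans (sq_le_sq.1 ?_)
  rw [hdet, mul_pow, sq (lam ^ n)]
  gcongr
  · exact (pow_nonneg hlam n).trans (ellipticMatrices.pow_le_det hlam hA)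
  · exact ellipticMatrices.pow_le_det hlam hA
  · exact ellipticMatrices.pow_le_det hlam hB

theorem exists_orthogonal_trace_diffDisplacement_le (hlam : 0 ≤ lam)
    (hA : A ∈ ellipticMatrices n lam Lam) (hB : B ∈ ellipticMatrices n lam Lam) (hα : α ≤ 1)
    {e : Fin n → ℝ} (he : e ⬝ᵥ e = 1) :
    ∃ Q ∈ orthogonalGroup (Fin n) ℝ, ((diffDisplacement A B Q)ᵀ * normRpowHessian α e *
      diffDisplacement A B Q).trace ≤ -ellipticityGap n lam Lam α := by
  obtain ⟨Q, hQ, hpolar⟩ := exists_orthogonal_card_mul_det_rpow_le_trace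
    (CFC.sqrt B * normRpowHessian α e * CFC.sqrt A)
  have hn : n ≠ 0 := by
    rintro rfl
    simp at he
  have hcross : n * (1 - α) ^ (1 / (n : ℝ)) * lam ≤
      (Qᵀ * (CFC.sqrt B * normRpowHessian α e * CFC.sqrt A)).trace := by
    calc n * (1 - α) ^ (1 / (n : ℝ)) * lam = n * ((1 - α) * lam ^ n) ^ (1 / (n : ℝ)) := by
          rw [Real.mul_rpow (sub_nonneg.2 hα) (by positivity), one_div,
            Real.pow_rpow_inv_natCast hlam hn, mul_assoc]
      _ ≤ n * |(CFC.sqrt B * normRpowHessian α e * CFC.sqrt A).det| ^ (1 / (n : ℝ)) := by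
          have : 0 ≤ (1 - α) * lam ^ n := mul_nonneg (sub_nonneg.2 hα) (by positivity)
          gcongr
          exact le_abs_det_sqrt_mul_hessian_mul_sqrt hlam hA hB he
      _ ≤ _ := by simpa using hpolar
  refine ⟨Q, hQ, ?_⟩
  rw [diffDisplacement, trace_sub_mul_conj (transpose_eq_of_nonneg (CFC.sqrt_nonneg _))
    (transpose_eq_of_nonneg (CFC.sqrt_nonneg _)) (transpose_normRpowHessian α e) hQ,
    ellipticMatrices.sqrt_mul_sqrt hlam hA, ellipticMatrices.sqrt_mul_sqrt hlam hB, ellipticityGap]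
  linarith [ellipticMatrices.trace_normRpowHessian_mul_le hα hA he,
    ellipticMatrices.trace_normRpowHessian_mul_le hα hB he]

theorem exists_orthogonal_diffDisplacement_eq_neg_smul (hlam : 0 < lam)
    (hA : A ∈ ellipticMatrices n lam Lam) (hB : B ∈ ellipticMatrices n lam Lam) {e : E n}
    (he : ‖e‖ = 1) :
    ∃ Q ∈ orthogonalGroup (Fin n) ℝ, ∃ y : E n, ‖y‖ = 1 ∧ ∃ a, 2 * √lam ≤ a ∧
      toEuclideanLin (diffDisplacement A B Q) y = -(a • e) := by
  obtain ⟨y₀, hy₀, a₀, ha₀, hAy⟩ := ellipticMatrices.exists_sqrt_eq_smul hlam hA he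
  obtain ⟨y₁, hy₁, a₁, ha₁, hBy⟩ := ellipticMatrices.exists_sqrt_eq_smul hlam hB he
  obtain ⟨Q, hQ, hQy⟩ := exists_orthogonal_map_eq (v := -y₀) (w := y₁) (by simp [hy₀, hy₁])
  refine ⟨Q, hQ, -y₀, by simpa using hy₀, a₀ + a₁, by linarith, ?_⟩
  rw [diffDisplacement, map_sub, LinearMap.sub_apply, toLpLin_mul_same, LinearMap.comp_apply, hQy,
    hBy, map_neg, hAy]
  module

end Ellipticity

section UniformBall

variable {F : Type*} [NormedAddCommGroup F] [InnerProductSpace ℝ F] [FiniteDimensional ℝ F]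
  [MeasurableSpace F] [BorelSpace F]

variable (F) in
/-- The uniform probability measure on the open unit ball: the integral against it is the mean
over the ball. -/
noncomputable def uniformBall : Measure F :=
  ProbabilityTheory.cond volume (ball 0 1)

instance : IsProbabilityMeasure (uniformBall F) :=
  ProbabilityTheory.cond_isProbabilityMeasure_of_finite (measure_ball_pos _ _ one_pos).ne'
    measure_ball_lt_top.ne

theorem integral_uniformBall (f : F → ℝ) : ∫ y, f y ∂uniformBall F = ⨍ y in ball 0 1, f y :=
  (setAverage_eq' _ f _).symm

theorem ae_norm_lt_one_uniformBall : ∀ᵐ y ∂uniformBall F, ‖y‖ < 1 := by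
  filter_upwards [ProbabilityTheory.ae_cond_mem (μ := volume) (measurableSet_ball (x := (0 : F)))]
    with y hy using mem_ball_zero_iff.1 hy

theorem integrable_uniformBall_iff {f : F → ℝ} :
    Integrable f (uniformBall F) ↔ IntegrableOn f (ball 0 1) :=
  integrable_smul_measure (ENNReal.inv_ne_zero.2 measure_ball_lt_top.ne)
    (ENNReal.inv_ne_top.2 (measure_ball_pos _ _ one_pos).ne')

theorem integrable_uniformBall_of_continuous {f : F → ℝ} (hf : Continuous f) :
    Integrable f (uniformBall F) :=
  integrable_uniformBall_iff.2 <| (hf.continuousOn.integrableOn_compact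
    (isCompact_closedBall 0 1)).mono_set ball_subset_closedBall

theorem measurePreserving_uniformBall (g : F ≃ₗᵢ[ℝ] F) :
    MeasurePreserving g (uniformBall F) (uniformBall F) := by
  have hrestrict := g.measurePreserving.restrict_preimage_emb
    g.toHomeomorph.measurableEmbedding (ball 0 1)
  rw [show g ⁻¹' ball 0 1 = ball 0 1 by ext; simp] at hrestrict
  exact hrestrict.smul_measure _

theorem integral_uniformBall_comp (g : F ≃ₗᵢ[ℝ] F) (f : F → ℝ) :
    ∫ y, f (g y) ∂uniformBall F = ∫ y, f y ∂uniformBall F :=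
  (measurePreserving_uniformBall g).integral_comp g.toHomeomorph.measurableEmbedding f

theorem integral_uniformBall_eq_zero_of_odd {f : F → ℝ} (hf : Function.Odd f) :
    ∫ y, f y ∂uniformBall F = 0 := by
  have hneg := integral_uniformBall_comp (LinearIsometryEquiv.neg ℝ) f
  simp only [LinearIsometryEquiv.coe_neg, hf.eq, integral_neg] at hneg
  linarith

theorem integral_norm_sq_uniformBall_pos [Nontrivial F] : 0 < ∫ y, ‖y‖ ^ 2 ∂uniformBall F := by
  rw [integral_pos_iff_support_of_nonneg (fun y => by positivity)
    (integrable_uniformBall_of_continuous (by fun_prop))]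
  have hsupport : Function.support (fun y : F => ‖y‖ ^ 2) = {0}ᶜ := by
    ext y
    simp
  have hzero : uniformBall F {0} = 0 :=
    ProbabilityTheory.cond_absolutelyContinuous (measure_singleton 0)
  rw [hsupport, prob_compl_eq_one_sub (measurableSet_singleton 0), hzero]
  simp

theorem uniformBall_ball {y₀ : F} {δ : ℝ} (hδ : 0 < δ) (h : ball y₀ δ ⊆ ball 0 1) :
    (uniformBall F).real (ball y₀ δ) = δ ^ Module.finrank ℝ F := by
  have hunit : (volume (ball (0 : F) 1)).toReal ≠ 0 :=
    ENNReal.toReal_ne_zero.2 ⟨(measure_ball_pos _ _ one_pos).ne', measure_ball_lt_top.ne⟩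
  rw [measureReal_def, uniformBall, ProbabilityTheory.cond_apply measurableSet_ball,
    Set.inter_eq_self_of_subset_right h, Measure.addHaar_ball_of_pos _ _ hδ, ENNReal.toReal_mul,
    ENNReal.toReal_mul, ENNReal.toReal_inv, ENNReal.toReal_ofReal (by positivity)]
  field_simp

theorem pow_mul_le_integral_uniformBall {f : F → ℝ} (hf : Integrable f (uniformBall F))
    (hf₀ : ∀ y, 0 ≤ f y) {y₀ : F} {δ b : ℝ} (hδ : 0 < δ) (hsub : ball y₀ δ ⊆ ball 0 1)
    (h : ∀ y ∈ ball y₀ δ, b ≤ f y) :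
    δ ^ Module.finrank ℝ F * b ≤ ∫ y, f y ∂uniformBall F := by
  calc δ ^ Module.finrank ℝ F * b = ∫ _ in ball y₀ δ, b ∂uniformBall F := by
        rw [setIntegral_const, smul_eq_mul, uniformBall_ball hδ hsub]
    _ ≤ ∫ y in ball y₀ δ, f y ∂uniformBall F :=
        setIntegral_mono_on (integrable_const b).integrableOn hf.integrableOn measurableSet_ball h
    _ ≤ ∫ y, f y ∂uniformBall F :=
        setIntegral_le_integral hf (Filter.Eventually.of_forall hf₀)

theorem integral_uniformBall_le_of_le_add_odd {f g l : F → ℝ} (hf : Continuous f)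
    (hg : Continuous g) (hl : Continuous l) (hodd : Function.Odd l)
    (h : ∀ y, ‖y‖ < 1 → f y ≤ g y + l y) :
    ∫ y, f y ∂uniformBall F ≤ ∫ y, g y ∂uniformBall F := by
  have hg := integrable_uniformBall_of_continuous hg
  have hl := integrable_uniformBall_of_continuous hl
  calc ∫ y, f y ∂uniformBall F ≤ ∫ y, (g y + l y) ∂uniformBall F :=
        integral_mono_ae (integrable_uniformBall_of_continuous hf) (hg.add hl)
          (ae_norm_lt_one_uniformBall.mono h)
    _ = ∫ y, g y ∂uniformBall F := by
        rw [integral_add hg hl, integral_uniformBall_eq_zero_of_odd hodd, add_zero]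

variable {G : Type*} [NormedAddCommGroup G] [InnerProductSpace ℝ G]

theorem integral_norm_add_smul_sq_le (v : G) (T : F →ₗ[ℝ] G) {m : ℝ}
    (hT : ∀ y, ‖T y‖ ≤ m * ‖y‖) (ε : ℝ) :
    ∫ y, ‖v + ε • T y‖ ^ 2 ∂uniformBall F ≤ ‖v‖ ^ 2 + m ^ 2 * ε ^ 2 := by
  have hcontinuous : Continuous T := T.continuous_of_finiteDimensional
  calc ∫ y, ‖v + ε • T y‖ ^ 2 ∂uniformBall F
      ≤ ∫ _, (‖v‖ ^ 2 + m ^ 2 * ε ^ 2) ∂uniformBall F := by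
        refine integral_uniformBall_le_of_le_add_odd (l := fun y => 2 * (ε * inner ℝ v (T y)))
          (by fun_prop) (by fun_prop) (by fun_prop) (fun y => by simp) fun y hy => ?_
        have hTy : ‖T y‖ ^ 2 ≤ m ^ 2 := by
          calc ‖T y‖ ^ 2 ≤ (m * ‖y‖) ^ 2 := by gcongr; exact hT y
            _ = m ^ 2 * ‖y‖ ^ 2 := mul_pow _ _ _
            _ ≤ m ^ 2 := mul_le_of_le_one_right (sq_nonneg m) (pow_le_one₀ (norm_nonneg y) hy.le)
        rw [norm_add_sq_real, inner_smul_right, norm_smul, mul_pow, Real.norm_eq_abs, sq_abs]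
        linarith [mul_le_mul_of_nonneg_left hTy (sq_nonneg ε)]
    _ = ‖v‖ ^ 2 + m ^ 2 * ε ^ 2 := by simp

theorem integral_norm_add_smul_rpow_le_add (v : G) (T : F →ₗ[ℝ] G) {m ε α : ℝ} (hm : 0 ≤ m)
    (hT : ∀ y, ‖T y‖ ≤ m * ‖y‖) (hε : 0 ≤ ε) (hα₀ : 0 ≤ α) (hα₁ : α ≤ 1) :
    ∫ y, ‖v + ε • T y‖ ^ α ∂uniformBall F ≤ ‖v‖ ^ α + (m * ε) ^ α := by
  have hcontinuous : Continuous T := T.continuous_of_finiteDimensional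
  calc ∫ y, ‖v + ε • T y‖ ^ α ∂uniformBall F
      ≤ ∫ _, (‖v‖ ^ α + (m * ε) ^ α) ∂uniformBall F := by
        refine integral_mono_ae (integrable_uniformBall_of_continuous
          (.rpow_const (by fun_prop) fun _ => .inr hα₀)) (integrable_const _) ?_
        filter_upwards [ae_norm_lt_one_uniformBall] with y hy
        have hstep : ‖ε • T y‖ ≤ m * ε := by
          rw [norm_smul, Real.norm_of_nonneg hε, mul_comm]
          gcongr
          exact (hT y).trans (mul_le_of_le_one_right hm hy.le)
        calc ‖v + ε • T y‖ ^ α ≤ (‖v‖ + m * ε) ^ α := by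
              gcongr
              exact (norm_add_le _ _).trans (by gcongr)
          _ ≤ ‖v‖ ^ α + (m * ε) ^ α :=
              Real.rpow_add_le_add_rpow (norm_nonneg v) (by positivity) hα₀ hα₁
    _ = ‖v‖ ^ α + (m * ε) ^ α := by simp

end UniformBall

section Moments

variable {ι : Type*} [Fintype ι]

variable (ι) in
/-- The second moment of one coordinate of a uniformly distributed point of the unit ball. -/
noncomputable def ballVariance : ℝ :=
  (∫ y, ‖y‖ ^ 2 ∂uniformBall (EuclideanSpace ℝ ι)) / Fintype.card ι

theorem ballVariance_nonneg : 0 ≤ ballVariance ι :=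
  div_nonneg (integral_nonneg fun _ => sq_nonneg _) (Nat.cast_nonneg _)

theorem ballVariance_pos [Nonempty ι] : 0 < ballVariance ι :=
  div_pos integral_norm_sq_uniformBall_pos (by exact_mod_cast Fintype.card_pos)

theorem integral_uniformBall_mul_of_ne {i j : ι} (hij : i ≠ j) :
    ∫ y, y i * y j ∂uniformBall (EuclideanSpace ℝ ι) = 0 := by
  classical
  let g : EuclideanSpace ℝ ι ≃ₗᵢ[ℝ] EuclideanSpace ℝ ι := LinearIsometryEquiv.piLpCongrRight 2
    fun k => if k = i then LinearIsometryEquiv.neg ℝ else LinearIsometryEquiv.refl ℝ ℝ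
  have hflip := integral_uniformBall_comp g fun y => y i * y j
  have hi : ∀ y, g y i = -y i := fun y => by simp [g]
  have hj : ∀ y, g y j = y j := fun y => by simp [g, hij.symm]
  simp only [hi, hj, neg_mul, integral_neg] at hflip
  linarith

theorem integral_uniformBall_sq (i : ι) :
    ∫ y, y i * y i ∂uniformBall (EuclideanSpace ℝ ι) = ballVariance ι := by
  classical
  have hswap : ∀ j, ∫ y, y j * y j ∂uniformBall (EuclideanSpace ℝ ι) =
      ∫ y, y i * y i ∂uniformBall (EuclideanSpace ℝ ι) := fun j => by
    let g : EuclideanSpace ℝ ι ≃ₗᵢ[ℝ] EuclideanSpace ℝ ι :=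
      LinearIsometryEquiv.piLpCongrLeft 2 ℝ ℝ (Equiv.swap i j)
    have hg : ∀ y, g y i = y j := fun y => by
      simp [g, LinearIsometryEquiv.piLpCongrLeft_apply, Equiv.piCongrLeft'_apply]
    simpa only [hg] using integral_uniformBall_comp g fun y => y i * y i
  have hcard : (Fintype.card ι : ℝ) ≠ 0 := by
    exact_mod_cast (Fintype.card_pos_iff.2 ⟨i⟩).ne'
  rw [ballVariance, eq_div_iff hcard]
  simp only [EuclideanSpace.real_norm_sq_eq]
  rw [integral_finsetSum _ fun j _ => integrable_uniformBall_of_continuous (by fun_prop)]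
  simp only [sq, hswap, Finset.sum_const, Finset.card_univ, nsmul_eq_mul, mul_comm]

theorem integral_uniformBall_dotProduct_mulVec (S : Matrix ι ι ℝ) :
    ∫ y, y.ofLp ⬝ᵥ S *ᵥ y.ofLp ∂uniformBall (EuclideanSpace ℝ ι) = ballVariance ι * S.trace := by
  have hexpand (y : EuclideanSpace ℝ ι) :
      y.ofLp ⬝ᵥ S *ᵥ y.ofLp = ∑ i, ∑ j, S i j * (y i * y j) := by
    simp only [dotProduct, mulVec, Finset.mul_sum, mul_left_comm]
  have hrow (i : ι) : ∫ y, ∑ j, S i j * (y i * y j) ∂uniformBall (EuclideanSpace ℝ ι) =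
      S i i * ballVariance ι := by
    rw [integral_finsetSum _ fun j _ => integrable_uniformBall_of_continuous (by fun_prop),
      Finset.sum_eq_single i (fun j _ hj => ?_) (by simp), integral_const_mul,
      integral_uniformBall_sq]
    rw [integral_const_mul, integral_uniformBall_mul_of_ne hj.symm, mul_zero]
  simp only [hexpand]
  rw [integral_finsetSum _ fun i _ => integrable_uniformBall_of_continuous (by fun_prop)]
  simp only [hrow, ← Finset.sum_mul, mul_comm (ballVariance ι), trace, diag]

end Moments

section AnnulusIndex

/-- The index `i` of the annulus `(i - 1) / 2 < ρ / s ≤ i / 2` containing the radius `ρ`. -/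
noncomputable def annulusIndex (s ρ : ℝ) : ℕ := ⌈2 * (ρ / s)⌉₊

theorem annulusIndex_le_iff {s ρ : ℝ} (hs : 0 < s) {k : ℕ} :
    annulusIndex s ρ ≤ k ↔ 2 * ρ ≤ k * s := by
  rw [annulusIndex, Nat.ceil_le, ← mul_div_assoc, div_le_iff₀ hs]

theorem annulusIndex_eq_iff {s ρ : ℝ} (hρ : 0 ≤ ρ / s) {i : ℕ} :
    annulusIndex s ρ = i ↔ ((i : ℝ) - 1) / 2 < ρ / s ∧ ρ / s ≤ i / 2 := by
  rw [annulusIndex]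
  rcases i with _ | i
  · rw [Nat.ceil_eq_zero]
    constructor
    · exact fun h => ⟨by norm_num; linarith, by norm_num; linarith⟩
    · rintro ⟨-, h⟩
      norm_num at h
      linarith
  · rw [Nat.ceil_eq_iff i.succ_ne_zero]
    push_cast
    constructor <;> rintro ⟨h₁, h₂⟩ <;> constructor <;> linarith

theorem annulusIndex_lt {s ρ ρ' : ℝ} (hs : 0 < s) (hρ : s / 2 < ρ)
    (hρ' : ρ' ≤ max (s / 2) (ρ - s / 2)) : annulusIndex s ρ' < annulusIndex s ρ := by
  obtain ⟨k, hk⟩ : ∃ k, annulusIndex s ρ = k + 2 := by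
    refine Nat.exists_eq_add_of_le' (not_lt.1 fun hlt => ?_)
    have := (annulusIndex_le_iff hs).1 (Nat.lt_succ_iff.1 hlt)
    push_cast at this
    linarith
  have hle := (annulusIndex_le_iff hs).1 hk.le
  rw [hk, Nat.lt_succ_iff, annulusIndex_le_iff hs]
  push_cast at hle ⊢
  rcases le_max_iff.1 hρ' with h | h
  · linarith [mul_nonneg k.cast_nonneg hs.le]
  · linarith

end AnnulusIndex

section StepFunction

variable {n : ℕ} {C α lam ε : ℝ}

theorem f₂_eq (hε : 0 ≤ ε) (N : ℕ) (x z : E n) :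
    f₂ C N α lam ε x z =
      if annulusIndex (√lam * ε) ‖x - z‖ ≤ 2 * N then
        C ^ (2 * (2 * N - annulusIndex (√lam * ε) ‖x - z‖)) * ε ^ α
      else 0 := by
  have hρ : 0 ≤ ‖x - z‖ / (√lam * ε) := by positivity
  simp only [f₂, ← annulusIndex_eq_iff hρ, Finset.sum_ite_eq, Finset.mem_range, Nat.lt_succ_iff]

theorem f₂_nonneg (hε : 0 ≤ ε) (N : ℕ) (x z : E n) : 0 ≤ f₂ C N α lam ε x z := by
  rw [f₂_eq hε]
  split_ifs
  · rw [pow_mul]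
    positivity
  · exact le_rfl

theorem f₂_le (hC : 1 ≤ C) (hε : 0 ≤ ε) (N : ℕ) (x z : E n) :
    f₂ C N α lam ε x z ≤ C ^ (4 * N) * ε ^ α := by
  rw [f₂_eq hε]
  split_ifs
  · exact mul_le_mul_of_nonneg_right (pow_le_pow_right₀ hC (by omega)) (by positivity)
  · positivity

theorem measurable_f₂ (hε : 0 ≤ ε) (N : ℕ) :
    Measurable fun p : E n × E n => f₂ C N α lam ε p.1 p.2 := by
  have hindex : Measurable fun p : E n × E n => annulusIndex (√lam * ε) ‖p.1 - p.2‖ :=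
    Nat.measurable_ceil.comp (by fun_prop)
  have hvalue : Measurable fun k : ℕ => if k ≤ 2 * N then C ^ (2 * (2 * N - k)) * ε ^ α else 0 :=
    measurable_from_top
  simp only [f₂_eq hε]
  exact hvalue.comp hindex

theorem rpow_le_f₂ (hC : 1 ≤ C) (hlam : 0 < lam) (hε : 0 < ε) {N : ℕ} {x z : E n}
    (h : ‖x - z‖ ≤ N * (√lam * ε)) : ε ^ α ≤ f₂ C N α lam ε x z := by
  have hindex : annulusIndex (√lam * ε) ‖x - z‖ ≤ 2 * N := by
    rw [annulusIndex_le_iff (by positivity)]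
    push_cast
    linarith
  rw [f₂_eq hε.le, if_pos hindex]
  exact le_mul_of_one_le_left (by positivity) (one_le_pow₀ hC)

theorem f₂_eq_zero (hlam : 0 < lam) (hε : 0 < ε) {N : ℕ} {x z : E n}
    (h : N * (√lam * ε) < ‖x - z‖) : f₂ C N α lam ε x z = 0 := by
  rw [f₂_eq hε.le, if_neg]
  rw [annulusIndex_le_iff (by positivity), not_le]
  push_cast
  linarith

theorem sq_mul_f₂_le_f₂ (hC : 1 ≤ C) (hε : 0 ≤ ε) (N : ℕ) {x z x' z' : E n}
    (h : annulusIndex (√lam * ε) ‖x' - z'‖ < annulusIndex (√lam * ε) ‖x - z‖) :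
    C ^ 2 * f₂ C N α lam ε x z ≤ f₂ C N α lam ε x' z' := by
  by_cases hindex : annulusIndex (√lam * ε) ‖x - z‖ ≤ 2 * N
  · rw [f₂_eq hε, f₂_eq hε, if_pos hindex, if_pos (h.le.trans hindex), ← mul_assoc, ← pow_add]
    exact mul_le_mul_of_nonneg_right (pow_le_pow_right₀ hC (by omega)) (by positivity)
  · rw [f₂_eq hε N x z, if_neg hindex, mul_zero]
    exact f₂_nonneg hε N x' z'

end StepFunction

section Coupled

variable {n : ℕ}

theorem continuous_f₁ {α : ℝ} (hα : 0 ≤ α) (C C' : ℝ) :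
    Continuous fun p : E n × E n => f₁ C C' α p.1 p.2 := by
  unfold f₁
  have : Continuous fun p : E n × E n => ‖p.1 - p.2‖ ^ α :=
    .rpow_const (by fun_prop) fun _ => .inr hα
  fun_prop

theorem continuous_coupling (A : E n → Matrix (Fin n) (Fin n) ℝ) (ε : ℝ) (x z : E n)
    (Q : Matrix (Fin n) (Fin n) ℝ) :
    Continuous fun y : E n => (x + ε • toEuclideanLin (CFC.sqrt (A x)) y,
      z + ε • toEuclideanLin (CFC.sqrt (A z) * Q) y) := by
  have := (toEuclideanLin (CFC.sqrt (A x))).continuous_of_finiteDimensional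
  have := (toEuclideanLin (CFC.sqrt (A z) * Q)).continuous_of_finiteDimensional
  fun_prop

variable {C α lam ε : ℝ} (A : E n → Matrix (Fin n) (Fin n) ℝ) (x z : E n)
  (Q : Matrix (Fin n) (Fin n) ℝ)

theorem integrable_coupled_f₁ (hα : 0 ≤ α) {C' : ℝ} :
    Integrable (coupled (f₁ C C' α) A ε x z Q) (uniformBall (E n)) := by
  have hcontinuous := (continuous_f₁ hα C C').comp (continuous_coupling A ε x z Q)
  exact integrable_uniformBall_of_continuous hcontinuous

theorem integrable_coupled_f₂ (hC : 1 ≤ C) (hε : 0 ≤ ε) (N : ℕ) :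
    Integrable (coupled (f₂ C N α lam ε) A ε x z Q) (uniformBall (E n)) := by
  refine .of_bound ((measurable_f₂ hε N).comp
    (continuous_coupling A ε x z Q).measurable).aestronglyMeasurable (C ^ (4 * N) * ε ^ α)
    (Filter.Eventually.of_forall fun y => ?_)
  exact (Real.norm_of_nonneg (f₂_nonneg hε N _ _)).trans_le (f₂_le hC hε N _ _)

theorem integrable_coupled_comparison (hC : 1 ≤ C) (hα : 0 ≤ α) (hε : 0 ≤ ε) (N : ℕ) (r : ℝ)
    (u : E n → ℝ) :
    Integrable (coupled (comparison C N α lam ε r u) A ε x z Q) (uniformBall (E n)) :=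
  (integrable_coupled_f₁ A x z Q hα).sub (integrable_coupled_f₂ A x z Q hC hε N)

end Coupled

section SecondOrder

variable {ι : Type*} [Fintype ι] [DecidableEq ι]

theorem norm_sq_sub_inner_sq_toEuclideanLin (α : ℝ) (e : EuclideanSpace ℝ ι) (M : Matrix ι ι ℝ)
    (y : EuclideanSpace ℝ ι) :
    ‖toEuclideanLin M y‖ ^ 2 - (2 - α) * inner ℝ e (toEuclideanLin M y) ^ 2 =
      y.ofLp ⬝ᵥ (Mᵀ * normRpowHessian α e.ofLp * M) *ᵥ y.ofLp := by
  rw [norm_sq_eq_dotProduct, inner_toEuclideanLin, ← mulVec_mulVec, ← mulVec_mulVec,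
    dotProduct_mulVec y.ofLp, vecMul_transpose, dotProduct_normRpowHessian_mulVec]
  rfl

theorem integral_norm_add_smul_rpow_le {α : ℝ} (hα₀ : 0 ≤ α) (hα₂ : α ≤ 2)
    {v : EuclideanSpace ℝ ι} {M : Matrix ι ι ℝ} {m ε : ℝ} (hm : 0 ≤ m)
    (hM : ∀ y, ‖toEuclideanLin M y‖ ≤ m * ‖y‖) (hε : 0 ≤ ε) (hv : m * ε < ‖v‖) :
    ∫ y, ‖v + ε • toEuclideanLin M y‖ ^ α ∂uniformBall (EuclideanSpace ℝ ι) ≤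
      ‖v‖ ^ α * (1 + α / 2 * ((ε / ‖v‖) ^ 2 * (ballVariance ι *
        (Mᵀ * normRpowHessian α (‖v‖⁻¹ • v).ofLp * M).trace)) + 6 * α * (m * ε / ‖v‖) ^ 3) := by
  set e := ‖v‖⁻¹ • v
  set T := Mᵀ * normRpowHessian α e.ofLp * M
  have hquadratic := norm_sq_sub_inner_sq_toEuclideanLin α e M
  have hcontinuous := (toEuclideanLin M).continuous_of_finiteDimensional
  have hcontinuousT : Continuous fun y : EuclideanSpace ℝ ι => y.ofLp ⬝ᵥ T *ᵥ y.ofLp := by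
    simp only [T, ← hquadratic]
    fun_prop
  have hodd := integral_uniformBall_le_of_le_add_odd
    (f := fun y => ‖v + ε • toEuclideanLin M y‖ ^ α)
    (g := fun y => ‖v‖ ^ α * (1 + 6 * α * (m * ε / ‖v‖) ^ 3) +
      ‖v‖ ^ α * (α / 2 * (ε / ‖v‖) ^ 2) * (y.ofLp ⬝ᵥ T *ᵥ y.ofLp))
    (l := fun y => ‖v‖ ^ α * (α * (ε / ‖v‖) * inner ℝ e (toEuclideanLin M y)))
    (.rpow_const (by fun_prop) fun _ => .inr hα₀) (by fun_prop) (by fun_prop)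
    (fun y => by simp) fun y hy => ?_
  · have hintegrable := integrable_uniformBall_of_continuous hcontinuousT
    rw [integral_add (integrable_const _) (hintegrable.const_mul _), integral_const,
      probReal_univ, one_smul, integral_const_mul, integral_uniformBall_dotProduct_mulVec] at hodd
    exact hodd.trans_eq (by ring)
  · have hstep : ‖ε • toEuclideanLin M y‖ ≤ m * ε := by
      rw [norm_smul, Real.norm_of_nonneg hε, mul_comm]
      gcongr
      exact (hM y).trans (mul_le_of_le_one_right hm hy.le)
    calc ‖v + ε • toEuclideanLin M y‖ ^ α
        ≤ _ := norm_add_rpow_le hα₀ hα₂ (hstep.trans_lt hv)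
      _ ≤ ‖v‖ ^ α * (1 + α * (inner ℝ e (ε • toEuclideanLin M y) / ‖v‖) +
          α / 2 * ((‖ε • toEuclideanLin M y‖ ^ 2 -
            (2 - α) * inner ℝ e (ε • toEuclideanLin M y) ^ 2) / ‖v‖ ^ 2) +
          6 * α * (m * ε / ‖v‖) ^ 3) := by gcongr
      _ = _ := by
        rw [← hquadratic, inner_smul_right, norm_smul, Real.norm_of_nonneg hε]
        ring

end SecondOrder

section Coupling

theorem one_add_quadratic_add_cubic_le {α κ c t m τ : ℝ} (hα : 0 ≤ α) (hκ : 0 ≤ κ) (ht : t ≤ -c)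
    (hcubic : 24 * m ^ 3 * τ ≤ κ * c) :
    1 + α / 2 * (τ ^ 2 * (κ * t)) + 6 * α * (m * τ) ^ 3 ≤ 1 - α / 4 * (κ * c) * τ ^ 2 := by
  have hκt : κ * t ≤ κ * -c := by gcongr
  have hquadratic := mul_le_mul_of_nonneg_left hκt (by positivity : 0 ≤ α / 2 * τ ^ 2)
  have herror := mul_le_mul_of_nonneg_left hcubic (by positivity : 0 ≤ α / 4 * τ ^ 2)
  linarith

variable {n : ℕ} {lam Lam α ε : ℝ} {A B : Matrix (Fin n) (Fin n) ℝ} {v : E n}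

theorem exists_orthogonal_integral_diff_rpow_le (hlam : 0 ≤ lam)
    (hA : A ∈ ellipticMatrices n lam Lam) (hB : B ∈ ellipticMatrices n lam Lam) (hα₀ : 0 ≤ α)
    (hα₁ : α ≤ 1) (hε : 0 ≤ ε) (hstep : 2 * √Lam * ε < ‖v‖)
    (hcubic : 24 * (2 * √Lam) ^ 3 * ε ≤
      ballVariance (Fin n) * ellipticityGap n lam Lam α * ‖v‖) :
    ∃ Q ∈ orthogonalGroup (Fin n) ℝ,
      ∫ y, ‖v + ε • toEuclideanLin (diffDisplacement A B Q) y‖ ^ α ∂uniformBall (E n) ≤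
        ‖v‖ ^ α - α / 4 * (ballVariance (Fin n) * ellipticityGap n lam Lam α) *
          ‖v‖ ^ (α - 2) * ε ^ 2 := by
  have hv : 0 < ‖v‖ := lt_of_le_of_lt (by positivity) hstep
  have hunit : ‖‖v‖⁻¹ • v‖ = 1 := norm_smul_inv_norm (𝕜 := ℝ) (norm_pos_iff.1 hv)
  have he : (‖v‖⁻¹ • v).ofLp ⬝ᵥ (‖v‖⁻¹ • v).ofLp = 1 := by
    rw [← norm_sq_eq_dotProduct, hunit, one_pow]
  obtain ⟨Q, hQ, htrace⟩ := exists_orthogonal_trace_diffDisplacement_le hlam hA hB hα₁ he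
  refine ⟨Q, hQ, ?_⟩
  have hexpand := integral_norm_add_smul_rpow_le hα₀ (hα₁.trans one_le_two) (by positivity)
    (norm_diffDisplacement_le hlam hA hB hQ) hε hstep
  have herror : 24 * (2 * √Lam) ^ 3 * (ε / ‖v‖) ≤
      ballVariance (Fin n) * ellipticityGap n lam Lam α := by
    rwa [← mul_div_assoc, div_le_iff₀ hv]
  have hgain := one_add_quadratic_add_cubic_le hα₀ ballVariance_nonneg htrace herror
  rw [← mul_div_assoc] at hgain
  have hrpow : ‖v‖ ^ (α - 2) * ε ^ 2 = ‖v‖ ^ α * (ε / ‖v‖) ^ 2 := by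
    rw [Real.rpow_sub hv, Real.rpow_two]
    field_simp
  refine (hexpand.trans (mul_le_mul_of_nonneg_left hgain (by positivity))).trans_eq ?_
  rw [mul_assoc _ (‖v‖ ^ (α - 2)), hrpow]
  ring

theorem norm_smul_add_smul_le {F : Type*} [NormedAddCommGroup F] [NormedSpace ℝ F]
    {s ρ ε : ℝ} (hε : 0 ≤ ε) {e w : F} (he : ‖e‖ = 1) (hρ : s * ε / 2 < ρ)
    (hw : ‖w + (3 / 4 * s) • e‖ ≤ s / 4) :
    ‖ρ • e + ε • w‖ ≤ max (s * ε / 2) (ρ - s * ε / 2) := by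
  have hsplit : ρ • e + ε • w = (ρ - 3 / 4 * (s * ε)) • e + ε • (w + (3 / 4 * s) • e) := by
    module
  have hmain : ‖ρ • e + ε • w‖ ≤ |ρ - 3 / 4 * (s * ε)| + ε * (s / 4) := by
    rw [hsplit]
    refine (norm_add_le _ _).trans ?_
    rw [norm_smul, norm_smul, he, mul_one, Real.norm_eq_abs, Real.norm_of_nonneg hε]
    gcongr
  rw [le_max_iff]
  rcases abs_cases (ρ - 3 / 4 * (s * ε)) with ⟨habs, -⟩ | ⟨habs, -⟩
  · right; linarith
  · left; linarith

theorem exists_orthogonal_ball_norm_diffDisplacement_add_le (hlam : 0 < lam) (hLam : lam ≤ Lam)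
    (hA : A ∈ ellipticMatrices n lam Lam) (hB : B ∈ ellipticMatrices n lam Lam) {e : E n}
    (he : ‖e‖ = 1) :
    ∃ Q ∈ orthogonalGroup (Fin n) ℝ, ∃ y₀ : E n, ball y₀ (√lam / (8 * √Lam)) ⊆ ball 0 1 ∧
      ∀ y ∈ ball y₀ (√lam / (8 * √Lam)),
        ‖toEuclideanLin (diffDisplacement A B Q) y + (3 / 4 * √lam) • e‖ ≤ √lam / 4 := by
  have hsqrt : 0 < √lam := Real.sqrt_pos.2 hlam
  have hsqrt_le : √lam ≤ √Lam := Real.sqrt_le_sqrt hLam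
  have hsqrt' : 0 < √Lam := hsqrt.trans_le hsqrt_le
  obtain ⟨Q, hQ, y₁, hy₁, a, ha, hDy₁⟩ :=
    exists_orthogonal_diffDisplacement_eq_neg_smul hlam hA hB he
  set D := toEuclideanLin (diffDisplacement A B Q)
  have ha₀ : 0 < a := by linarith
  let t := 3 / 4 * √lam / a
  have hta : t * a = 3 / 4 * √lam := div_mul_cancel₀ _ ha₀.ne'
  refine ⟨Q, hQ, t • y₁, ball_subset_ball' ?_, fun y hy => ?_⟩
  · have hδ : √lam / (8 * √Lam) ≤ 1 / 8 := by
      rw [div_le_div_iff₀ (by positivity) (by norm_num)]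
      linarith
    have ht : t ≤ 3 / 8 := by
      rw [div_le_iff₀ ha₀]
      linarith
    rw [dist_zero_right, norm_smul, hy₁, mul_one, Real.norm_of_nonneg (by positivity)]
    linarith
  · have hDt : D (t • y₁) = -((3 / 4 * √lam) • e) := by
      rw [map_smul, hDy₁, smul_neg, smul_smul, hta]
    calc ‖D y + (3 / 4 * √lam) • e‖ = ‖D (y - t • y₁)‖ := by
          rw [map_sub, hDt, sub_neg_eq_add]
      _ ≤ 2 * √Lam * ‖y - t • y₁‖ := norm_diffDisplacement_le hlam.le hA hB hQ _
      _ ≤ 2 * √Lam * (√lam / (8 * √Lam)) := by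
          gcongr
          exact (mem_ball_iff_norm.1 hy).le
      _ = √lam / 4 := by
          field_simp
          norm_num

end Coupling

variable {n : ℕ} {C α lam Lam ε r : ℝ} {N : ℕ} {A : E n → Matrix (Fin n) (Fin n) ℝ}
  {u : E n → ℝ} {x z : E n} {Q : Matrix (Fin n) (Fin n) ℝ}

section Average

theorem supBall_nonneg (u : E n → ℝ) (ρ : ℝ) : 0 ≤ supBall u ρ :=
  Real.sSup_nonneg (Set.forall_mem_image.2 fun _ _ => abs_nonneg _)

theorem coupled_sub (A : E n → Matrix (Fin n) (Fin n) ℝ) (ε : ℝ) (x z : E n)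
    (Q : Matrix (Fin n) (Fin n) ℝ) (y : E n) :
    x + ε • toEuclideanLin (CFC.sqrt (A x)) y - (z + ε • toEuclideanLin (CFC.sqrt (A z) * Q) y) =
      x - z + ε • toEuclideanLin (diffDisplacement (A x) (A z) Q) y := by
  rw [diffDisplacement, map_sub, LinearMap.sub_apply]
  module

theorem coupled_add (A : E n → Matrix (Fin n) (Fin n) ℝ) (ε : ℝ) (x z : E n)
    (Q : Matrix (Fin n) (Fin n) ℝ) (y : E n) :
    x + ε • toEuclideanLin (CFC.sqrt (A x)) y + (z + ε • toEuclideanLin (CFC.sqrt (A z) * Q) y) =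
      x + z + ε • toEuclideanLin (sumDisplacement (A x) (A z) Q) y := by
  rw [sumDisplacement, map_add, LinearMap.add_apply]
  module

theorem integral_coupled_f₁_le {C' : ℝ} (hC' : 0 ≤ C') (hlam : 0 ≤ lam) (hLam : 0 ≤ Lam)
    (hAx : A x ∈ ellipticMatrices n lam Lam) (hAz : A z ∈ ellipticMatrices n lam Lam)
    (hQ : Q ∈ orthogonalGroup (Fin n) ℝ) (hα : 0 ≤ α) :
    ∫ y, coupled (f₁ C C' α) A ε x z Q y ∂uniformBall (E n) ≤
      C * ∫ y, ‖x - z + ε • toEuclideanLin (diffDisplacement (A x) (A z) Q) y‖ ^ α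
          ∂uniformBall (E n) +
        C' * (‖x + z‖ ^ 2 + 4 * Lam * ε ^ 2) := by
  have := (toEuclideanLin (diffDisplacement (A x) (A z) Q)).continuous_of_finiteDimensional
  have := (toEuclideanLin (sumDisplacement (A x) (A z) Q)).continuous_of_finiteDimensional
  have hsum := integral_norm_add_smul_sq_le (x + z) _ (norm_sumDisplacement_le hlam hAx hAz hQ) ε
  rw [mul_pow, Real.sq_sqrt hLam] at hsum
  simp only [coupled, f₁, coupled_sub, coupled_add]
  rw [integral_add, integral_const_mul, integral_const_mul]
  · gcongr
    exact hsum.trans_eq (by norm_num)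
  · exact (integrable_uniformBall_of_continuous
      (.rpow_const (by fun_prop) fun _ => .inr hα)).const_mul _
  · exact (integrable_uniformBall_of_continuous (by fun_prop)).const_mul _

theorem integral_coupled_comparison (hC : 1 ≤ C) (hα : 0 ≤ α) (hε : 0 ≤ ε) :
    ∫ y, coupled (comparison C N α lam ε r u) A ε x z Q y ∂uniformBall (E n) =
      ∫ y, coupled (f₁ C (2 / (3 * r ^ 2) * supBall u (2 * r)) α) A ε x z Q y ∂uniformBall (E n) -
        ∫ y, coupled (f₂ C N α lam ε) A ε x z Q y ∂uniformBall (E n) :=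
  integral_sub (integrable_coupled_f₁ A x z Q hα) (integrable_coupled_f₂ A x z Q hC hε N)

end Average

/-- The constants `C` for which the comparison argument closes, where `K` is the coefficient of
`|x + z|²` in the comparison function. -/
structure IsLargeConstant (n : ℕ) (lam Lam r α K C : ℝ) : Prop where
  one_le : 1 ≤ C
  step_le : 2 * √Lam ≤ C * √lam
  cubic_le : 24 * (2 * √Lam) ^ 3 ≤
    ballVariance (Fin n) * ellipticityGap n lam Lam α * (C * √lam)
  far_lt : 4 * Lam * K + 1 <
    C * (α / 4 * (ballVariance (Fin n) * ellipticityGap n lam Lam α) * (2 * r) ^ (α - 2))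
  near_lt : (4 * Lam * K + 1) * (4 * r / √lam) ^ (2 - α) + C * (2 * √Lam) ^ α + 1 <
    C ^ 2 * (√lam / (8 * √Lam)) ^ n

theorem eventually_add_mul_lt_sq_mul {a b c : ℝ} (hc : 0 < c) :
    ∀ᶠ C : ℝ in Filter.atTop, a + C * b + 1 < C ^ 2 * c := by
  filter_upwards [Filter.eventually_ge_atTop 1, Filter.eventually_gt_atTop ((|a| + b + 1) / c)]
    with C hC₁ hC
  have hlinear := mul_lt_mul_of_pos_left ((div_lt_iff₀ hc).1 hC) (one_pos.trans_le hC₁)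
  have ha : a ≤ C * |a| := (le_abs_self a).trans (le_mul_of_one_le_left (abs_nonneg a) hC₁)
  linarith

theorem eventually_isLargeConstant (hn : 2 ≤ n) (hlam : 0 < lam) (hLam : 0 < Lam) (hr : 0 < r)
    (hα : SmallExponent n lam Lam α) (K : ℝ) :
    ∀ᶠ C : ℝ in Filter.atTop, IsLargeConstant n lam Lam r α K C := by
  have : Nonempty (Fin n) := ⟨⟨0, by omega⟩⟩
  have hgap : 0 < ballVariance (Fin n) * ellipticityGap n lam Lam α :=
    mul_pos ballVariance_pos (hα.ellipticityGap_pos hn hlam)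
  have hα₀ : 0 < α := hα.1
  have hsqrt : 0 < √lam := Real.sqrt_pos.2 hlam
  have hlinear (a : ℝ) {b : ℝ} (hb : 0 < b) : ∀ᶠ C : ℝ in Filter.atTop, a < C * b :=
    (Filter.tendsto_id.atTop_mul_const hb).eventually_gt_atTop a
  filter_upwards [Filter.eventually_ge_atTop 1, hlinear (2 * √Lam) hsqrt,
    hlinear (24 * (2 * √Lam) ^ 3) (mul_pos hgap hsqrt),
    hlinear (4 * Lam * K + 1) (b := α / 4 * (ballVariance (Fin n) * ellipticityGap n lam Lam α) *
      (2 * r) ^ (α - 2)) (by positivity),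
    eventually_add_mul_lt_sq_mul (a := (4 * Lam * K + 1) * (4 * r / √lam) ^ (2 - α))
      (b := (2 * √Lam) ^ α) (c := (√lam / (8 * √Lam)) ^ n) (by positivity)]
    with C hone hstep hcubic hfar hnear
  exact ⟨hone, hstep.le, by linarith, hfar, hnear⟩

theorem mul_sq_add_mul_rpow_add_lt {a b q ε ε₀ α F : ℝ} (ha : 0 ≤ a) (hb : 0 ≤ b) (hε : 0 < ε)
    (hε₀ : ε ≤ ε₀) (hα : α ≤ 2) (hF : ε ^ α ≤ F) (hq : a * ε₀ ^ (2 - α) + b + 1 < q) :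
    a * ε ^ 2 + b * ε ^ α + F < q * F := by
  have hpow : ε ^ 2 = ε ^ (2 - α) * ε ^ α := by
    rw [← Real.rpow_add hε, sub_add_cancel, Real.rpow_two]
  have hε₀' : 0 < ε₀ := hε.trans_le hε₀
  calc a * ε ^ 2 + b * ε ^ α + F = (a * ε ^ (2 - α) + b) * ε ^ α + F := by rw [hpow]; ring
    _ ≤ (a * ε₀ ^ (2 - α) + b) * ε ^ α + F := by
        gcongr
    _ ≤ (a * ε₀ ^ (2 - α) + b) * F + F := by gcongr
    _ = (a * ε₀ ^ (2 - α) + b + 1) * F := by ring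
    _ < q * F := mul_lt_mul_of_pos_right hq ((Real.rpow_pos_of_pos hε α).trans_le hF)

theorem exists_orthogonal_le_integral_coupled_f₂ (hC : 1 ≤ C) (hlam : 0 < lam) (hLam : lam ≤ Lam)
    (hε : 0 < ε) (hAx : A x ∈ ellipticMatrices n lam Lam)
    (hAz : A z ∈ ellipticMatrices n lam Lam) (hxz : 1 / 2 * √lam * ε < ‖x - z‖) (N : ℕ) :
    ∃ Q ∈ orthogonalGroup (Fin n) ℝ,
      (√lam / (8 * √Lam)) ^ n * (C ^ 2 * f₂ C N α lam ε x z) ≤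
        ∫ y, coupled (f₂ C N α lam ε) A ε x z Q y ∂uniformBall (E n) := by
  have hLam₀ : 0 < Lam := hlam.trans_le hLam
  have hpos : 0 < ‖x - z‖ := lt_trans (by positivity) hxz
  have he : ‖‖x - z‖⁻¹ • (x - z)‖ = 1 := norm_smul_inv_norm (𝕜 := ℝ) (norm_pos_iff.1 hpos)
  have hpolar : x - z = ‖x - z‖ • ‖x - z‖⁻¹ • (x - z) := (smul_inv_smul₀ hpos.ne' _).symm
  obtain ⟨Q, hQ, y₀, hsub, hcontract⟩ :=
    exists_orthogonal_ball_norm_diffDisplacement_add_le hlam hLam hAx hAz he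
  have hintegral := pow_mul_le_integral_uniformBall (f := coupled (f₂ C N α lam ε) A ε x z Q)
    (b := C ^ 2 * f₂ C N α lam ε x z) (integrable_coupled_f₂ A x z Q hC hε.le N)
    (fun _ => f₂_nonneg hε.le N _ _) (by positivity) hsub fun y hy => ?_
  · exact ⟨Q, hQ, by simpa only [finrank_euclideanSpace_fin] using hintegral⟩
  · refine sq_mul_f₂_le_f₂ hC hε.le N (annulusIndex_lt (by positivity) (by linarith) ?_)
    rw [coupled_sub]
    nth_rewrite 1 [hpolar]
    exact norm_smul_add_smul_le hε.le he (by linarith) (hcontract y hy)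

section Comparison

variable (hC : IsLargeConstant n lam Lam r α (2 / (3 * r ^ 2) * supBall u (2 * r)) C)
  (hα₀ : 0 ≤ α) (hα₁ : α ≤ 1) (hlam : 0 < lam) (hLam : lam ≤ Lam) (hε : 0 < ε)
  (hAx : A x ∈ ellipticMatrices n lam Lam) (hAz : A z ∈ ellipticMatrices n lam Lam)
  (hr : ‖x - z‖ < 2 * r)
include hC hα₀ hα₁ hlam hLam hε hAx hAz hr

theorem exists_orthogonal_integral_comparison_lt_of_near (hxz : 1 / 2 * √lam * ε < ‖x - z‖)
    (hN : ‖x - z‖ ≤ N * (√lam * ε)) :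
    ∃ Q ∈ orthogonalGroup (Fin n) ℝ,
      ∫ y, coupled (comparison C N α lam ε r u) A ε x z Q y ∂uniformBall (E n) + ε ^ 2 <
        comparison C N α lam ε r u x z := by
  have hLam₀ : 0 < Lam := hlam.trans_le hLam
  have hC₁ := hC.one_le
  have hK : 0 ≤ 2 / (3 * r ^ 2) * supBall u (2 * r) :=
    mul_nonneg (by positivity) (supBall_nonneg u _)
  obtain ⟨Q, hQ, hf₂⟩ := exists_orthogonal_le_integral_coupled_f₂ (C := C) (α := α) hC₁ hlam hLam
    hε hAx hAz hxz N
  have hf₁ := integral_coupled_f₁_le (C := C) (ε := ε) hK hlam.le hLam₀.le hAx hAz hQ hα₀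
  have hdiff := mul_le_mul_of_nonneg_left (integral_norm_add_smul_rpow_le_add (x - z)
    (toEuclideanLin (diffDisplacement (A x) (A z) Q)) (by positivity)
    (norm_diffDisplacement_le hlam.le hAx hAz hQ) hε.le hα₀ hα₁) (zero_le_one.trans hC₁)
  have hε_le : ε ≤ 4 * r / √lam := by
    rw [le_div_iff₀ (Real.sqrt_pos.2 hlam)]
    linarith
  have hclose := mul_sq_add_mul_rpow_add_lt (by positivity) (by positivity) hε hε_le
    (hα₁.trans one_le_two) (rpow_le_f₂ hC₁ hlam hε hN) hC.near_lt
  rw [Real.mul_rpow (by positivity) hε.le] at hdiff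
  refine ⟨Q, hQ, ?_⟩
  rw [integral_coupled_comparison hC₁ hα₀ hε.le, comparison, f₁]
  linarith

theorem exists_orthogonal_integral_comparison_lt_of_far
    (hgap : 0 ≤ ellipticityGap n lam Lam α) (hCN : C ≤ N) (hN : N * (√lam * ε) < ‖x - z‖) :
    ∃ Q ∈ orthogonalGroup (Fin n) ℝ,
      ∫ y, coupled (comparison C N α lam ε r u) A ε x z Q y ∂uniformBall (E n) + ε ^ 2 <
        comparison C N α lam ε r u x z := by
  have hLam₀ : 0 < Lam := hlam.trans_le hLam
  have hC₀ : 0 < C := one_pos.trans_le hC.one_le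
  have hκ := mul_nonneg (ballVariance_nonneg (ι := Fin n)) hgap
  have hfar : C * √lam * ε < ‖x - z‖ := by
    refine lt_of_le_of_lt ?_ hN
    rw [mul_assoc]
    gcongr
  have hpos : 0 < ‖x - z‖ := lt_of_le_of_lt (by positivity) hfar
  have hstep : 2 * √Lam * ε < ‖x - z‖ :=
    (mul_le_mul_of_nonneg_right hC.step_le hε.le).trans_lt hfar
  have hcubic := (mul_le_mul_of_nonneg_right hC.cubic_le hε.le).trans
    ((mul_assoc _ _ ε).trans_le (mul_le_mul_of_nonneg_left hfar.le hκ))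
  obtain ⟨Q, hQ, hgain⟩ := exists_orthogonal_integral_diff_rpow_le hlam.le hAx hAz hα₀ hα₁ hε.le
    hstep hcubic
  have hK : 0 ≤ 2 / (3 * r ^ 2) * supBall u (2 * r) :=
    mul_nonneg (by positivity) (supBall_nonneg u _)
  have hf₁ := integral_coupled_f₁_le (C := C) (ε := ε) hK hlam.le hLam₀.le hAx hAz hQ hα₀
  have hf₂ : 0 ≤ ∫ y, coupled (f₂ C N α lam ε) A ε x z Q y ∂uniformBall (E n) :=
    integral_nonneg fun _ => f₂_nonneg hε.le N _ _
  have hrpow : (2 * r) ^ (α - 2) ≤ ‖x - z‖ ^ (α - 2) :=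
    Real.rpow_le_rpow_of_nonpos hpos hr.le (by linarith)
  have hbeat : (4 * Lam * (2 / (3 * r ^ 2) * supBall u (2 * r)) + 1) * ε ^ 2 <
      C * (α / 4 * (ballVariance (Fin n) * ellipticityGap n lam Lam α) *
        ‖x - z‖ ^ (α - 2)) * ε ^ 2 := by
    refine mul_lt_mul_of_pos_right (hC.far_lt.trans_le ?_) (by positivity)
    gcongr
  have hdiff := mul_le_mul_of_nonneg_left hgain hC₀.le
  refine ⟨Q, hQ, ?_⟩
  rw [integral_coupled_comparison hC.one_le hα₀ hε.le, comparison, f₂_eq_zero hlam hε hN, f₁]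
  linarith

end Comparison

end EllipsoidProcess

theorem mainTheorem3 :
    -- `C₀` depends on `n, lam, Lam, r, α, sup_{B_{2r}} |u|`, and `N₀` on `lam, Lam, C`
    ∃ (C₀ : ℕ → ℝ → ℝ → ℝ → ℝ → ℝ → ℝ) (N₀ : ℝ → ℝ → ℝ → ℕ),
      ∀ (n : ℕ) (lam Lam : ℝ), 2 ≤ n → 0 < lam → 1 ≤ Lam / lam →
        Lam / lam < ((n : ℝ) + 1) / ((n : ℝ) - 1) →
        (∃ α₀ : ℝ, 0 < α₀ ∧ ∀ α : ℝ, 0 < α → α < α₀ →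
          EllipsoidProcess.SmallExponent n lam Lam α) ∧
        ∀ α : ℝ, EllipsoidProcess.SmallExponent n lam Lam α →
        ∀ (r ε : ℝ), 0 < r → 0 < ε →
        ∀ (Ω : Set (EllipsoidProcess.E n))
          (A : EllipsoidProcess.E n → Matrix (Fin n) (Fin n) ℝ)
          (u : EllipsoidProcess.E n → ℝ),
          Metric.ball (0 : EllipsoidProcess.E n) (2 * r) ⊆ Ω →
          (∀ x ∈ Ω, A x ∈ EllipsoidProcess.ellipticMatrices n lam Lam) →
          BddAbove ((fun x => |u x|) '' Metric.ball (0 : EllipsoidProcess.E n) (2 * r)) →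
        ∀ (C : ℝ) (N : ℕ),
          C₀ n lam Lam r α (EllipsoidProcess.supBall u (2 * r)) ≤ C → N₀ lam Lam C ≤ N →
        ∀ x ∈ Metric.ball (0 : EllipsoidProcess.E n) r,
        ∀ z ∈ Metric.ball (0 : EllipsoidProcess.E n) r,
          1 / 2 * √lam * ε < ‖x - z‖ →
          ∃ Q ∈ Matrix.orthogonalGroup (Fin n) ℝ,
            MeasureTheory.IntegrableOn
              (EllipsoidProcess.coupled (EllipsoidProcess.comparison C N α lam ε r u) A ε x z Q)
              (Metric.ball 0 1) ∧
            (⨍ y in Metric.ball (0 : EllipsoidProcess.E n) 1,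
              EllipsoidProcess.coupled (EllipsoidProcess.comparison C N α lam ε r u) A ε x z Q y)
                + ε ^ 2
              < EllipsoidProcess.comparison C N α lam ε r u x z := by
  choose! C₀ hC₀ using fun n lam Lam r α S hn hlam hLam hr hα => Filter.eventually_atTop.1
    (EllipsoidProcess.eventually_isLargeConstant (n := n) (lam := lam) (Lam := Lam) (r := r)
      (α := α) hn hlam hLam hr hα (2 / (3 * r ^ 2) * S))
  refine ⟨C₀, fun _ _ C => ⌈C⌉₊, fun n lam Lam hn hlam hdistortion₁ hdistortion => ⟨
    EllipsoidProcess.exists_forall_smallExponent hdistortion, ?_⟩⟩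
  intro α hα r ε hr hε Ω A u hΩ hA _ C N hC hN x hx z hz hxz
  have hLam : lam ≤ Lam := (one_le_div hlam).1 hdistortion₁
  have hlarge := hC₀ n lam Lam r α _ hn hlam (hlam.trans_le hLam) hr hα C hC
  have hsub : Metric.ball 0 r ⊆ Ω := (Metric.ball_subset_ball (by linarith)).trans hΩ
  have hdiameter : ‖x - z‖ < 2 * r := by
    rw [mem_ball_zero_iff] at hx hz
    exact (norm_sub_le x z).trans_lt (by linarith)
  obtain ⟨Q, hQ, hlt⟩ := (le_or_gt ‖x - z‖ (N * (√lam * ε))).elim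
    (EllipsoidProcess.exists_orthogonal_integral_comparison_lt_of_near hlarge hα.1.le hα.2.1.le
      hlam hLam hε (hA x (hsub hx)) (hA z (hsub hz)) hdiameter hxz)
    (EllipsoidProcess.exists_orthogonal_integral_comparison_lt_of_far hlarge hα.1.le hα.2.1.le
      hlam hLam hε (hA x (hsub hx)) (hA z (hsub hz)) hdiameter (hα.ellipticityGap_pos hn hlam).le
      (Nat.ceil_le.1 hN))
  rw [EllipsoidProcess.integral_uniformBall] at hlt
  exact ⟨Q, hQ, EllipsoidProcess.integrable_uniformBall_iff.1
    (EllipsoidProcess.integrable_coupled_comparison A x z Q hlarge.one_le hα.1.le hε.le N r u), hlt⟩
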